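/- Let $\mathcal{O}_7$ be the ring of algebraic integers of $\mathbb{K}=\mathbb{Q}(i\sqrt 7)\subset\mathbb{C}$, let $J=\begin{pmatrix}0&0&1\\0&1&0\\1&0&0\end{pmatrix}$, and equip $\mathbb{C}^3$ with the Hermitian form $\langle v,w\rangle=w^*Jv$ of signature $(2,1)$. Let $U(J)=\{A\in GL(3,\mathbb{C}) : A^*JA=J\}$, let $U(J,\mathcal{O}_7)=U(J)\cap GL(3,\mathcal{O}_7)$, and let $\Gamma=PU(J,\mathcal{O}_7)$ be the image of $U(J,\mathcal{O}_7)$ in $PGL(3,\mathbb{C})$. A vector $v\in\mathcal{O}_7^3$ is primitive if its entries have greatest common divisor $1$; its square norm is $\langle v,v\rangle$. Let $H^2_{\mathbb{C}}=\{[x]\in\mathbb{P}^2(\mathbb{C}) : \langle x,x\rangle<0\}$ be the complex hyperbolic plane. For $j=1,2$, a $j$-line is a complex line $\{[x]\in H^2_{\mathbb{C}} : \langle x,v\rangle=0\}$ polar to a primitive vector $v\in\mathcal{O}_7^3$ with $\langle v,v\rangle=j$. Then, for each $j\in\{1,2\}$, the group $U(J,\mathcal{O}_7)$ acts transitively on the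 (nonempty) set of primitive vectors of square norm $j$ in $\mathcal{O}_7^3$. Moreover $\Gamma$ acts transitively on the (nonempty) set of $j$-lines. -/

import Mathlib

open scoped Matrix MatrixGroups LinearAlgebra.Projectivization NumberField Pointwise

noncomputable section

namespace PicardSeven

/-- The imaginary quadratic field `K = ℚ(i√7)`, as a subfield of `ℂ`. -/
abbrev K : IntermediateField ℚ ℂ :=
  IntermediateField.adjoin ℚ {Complex.I * (Real.sqrt 7 : ℂ)}

/-- The ring `𝓞₇` of algebraic integers of `K`. -/
abbrev O7 : Type := 𝓞 K

/-- The Hermitian matrix (of signature `(2,1)`) with ones on the antidiagonal. -/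
def J : Matrix (Fin 3) (Fin 3) ℂ :=
  !![0, 0, 1;
     0, 1, 0;
     1, 0, 0]

/-- The Hermitian form `⟨v, w⟩ = w* J v`, linear in `v` and conjugate-linear in `w`. -/
def herm (v w : Fin 3 → ℂ) : ℂ := star w ⬝ᵥ (J *ᵥ v)

/-- The unitary group `U(J)` of the Hermitian form: the matrices `A` with `A* J A = J`. -/
def UJ : Subgroup (GL (Fin 3) ℂ) where
  carrier := {A | (A : Matrix (Fin 3) (Fin 3) ℂ)ᴴ * J * (A : Matrix (Fin 3) (Fin 3) ℂ) = J}
  one_mem' := by simp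
  mul_mem' := by
    intro A B hA hB
    simp only [Set.mem_ofPred_eq, Units.val_mul, Matrix.conjTranspose_mul] at *
    calc (B : Matrix (Fin 3) (Fin 3) ℂ)ᴴ * (A : Matrix (Fin 3) (Fin 3) ℂ)ᴴ * J *
          ((A : Matrix (Fin 3) (Fin 3) ℂ) * (B : Matrix (Fin 3) (Fin 3) ℂ))
        = (B : Matrix (Fin 3) (Fin 3) ℂ)ᴴ *
            ((A : Matrix (Fin 3) (Fin 3) ℂ)ᴴ * J * (A : Matrix (Fin 3) (Fin 3) ℂ)) *
            (B : Matrix (Fin 3) (Fin 3) ℂ) := by simp only [Matrix.mul_assoc]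
      _ = J := by rw [hA, hB]
  inv_mem' := by
    intro A hA
    simp only [Set.mem_ofPred_eq] at *
    have h1 : (A : Matrix (Fin 3) (Fin 3) ℂ) * ((A⁻¹ : GL (Fin 3) ℂ) : Matrix _ _ ℂ) = 1 := by
      rw [← Units.val_mul, mul_inv_cancel, Units.val_one]
    have h2 : ((A⁻¹ : GL (Fin 3) ℂ) : Matrix _ _ ℂ)ᴴ * (A : Matrix (Fin 3) (Fin 3) ℂ)ᴴ = 1 := by
      rw [← Matrix.conjTranspose_mul, h1, Matrix.conjTranspose_one]
    calc ((A⁻¹ : GL (Fin 3) ℂ) : Matrix _ _ ℂ)ᴴ * J * ((A⁻¹ : GL (Fin 3) ℂ) : Matrix _ _ ℂ)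
        = ((A⁻¹ : GL (Fin 3) ℂ) : Matrix _ _ ℂ)ᴴ *
            ((A : Matrix (Fin 3) (Fin 3) ℂ)ᴴ * J * (A : Matrix (Fin 3) (Fin 3) ℂ)) *
            ((A⁻¹ : GL (Fin 3) ℂ) : Matrix _ _ ℂ) := by rw [hA]
      _ = (((A⁻¹ : GL (Fin 3) ℂ) : Matrix _ _ ℂ)ᴴ * (A : Matrix (Fin 3) (Fin 3) ℂ)ᴴ) * J *
            ((A : Matrix (Fin 3) (Fin 3) ℂ) * ((A⁻¹ : GL (Fin 3) ℂ) : Matrix _ _ ℂ)) := by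
          simp only [Matrix.mul_assoc]
      _ = J := by rw [h1, h2, Matrix.one_mul, Matrix.mul_one]

/-- `U(J, 𝓞₇) = U(J) ∩ GL(3, 𝓞₇)`, where `GL(3, 𝓞₇)` is embedded in `GL(3, ℂ)`. -/
def UJO7 : Subgroup (GL (Fin 3) ℂ) :=
  UJ ⊓ (Matrix.GeneralLinearGroup.map (n := Fin 3) (algebraMap O7 ℂ)).range

/-- The Picard group `Γ = PU(J, 𝓞₇)`: the image of `U(J, 𝓞₇)` in `PGL(3, ℂ)`. -/
def Γ : Subgroup PGL(Fin 3, ℂ) := UJO7.map Matrix.ProjGenLinGroup.mk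

/-- A vector of `𝓞₇³` is primitive if its entries have greatest common divisor `1`, i.e. if
their only common divisors are the units. -/
def IsPrimitive (v : Fin 3 → O7) : Prop := ∀ d : O7, (∀ i, d ∣ v i) → IsUnit d

/-- The primitive vectors of `𝓞₇³` of square norm `j`, viewed in `ℂ³`. -/
def primitiveVectors (j : ℕ) : Set (Fin 3 → ℂ) :=
  {v | herm v v = j ∧ ∃ u : Fin 3 → O7, IsPrimitive u ∧ v = fun i => algebraMap O7 ℂ (u i)}

/-- The complex hyperbolic plane: the points of `ℙ²(ℂ)` represented by negative vectors. -/
def hyperbolicPlane : Set (ℙ ℂ (Fin 3 → ℂ)) := {p | (herm p.rep p.rep).re < 0}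

/-- The complex line of the complex hyperbolic plane polar to `v`: its points are the `[x]` with
`⟨x, v⟩ = 0`. -/
def polarLine (v : Fin 3 → ℂ) : Set (ℙ ℂ (Fin 3 → ℂ)) :=
  {p | p ∈ hyperbolicPlane ∧ herm p.rep v = 0}

/-- The set of `j`-lines: the complex lines polar to some primitive vector of square norm `j`. -/
def jLines (j : ℕ) : Set (Set (ℙ ℂ (Fin 3 → ℂ))) := polarLine '' primitiveVectors j

end PicardSeven

end

/-! The ring `O7` is `ℤ[om]`, which is Euclidean for the norm, so primitive vectors are those with a
Bézout relation (`Unimodular`). Both norms are themselves norms of ring elements: `1 = |1|²` and `2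
= |om|²`. This makes the plane orthogonal to `v` isotropic over `K`, so `v` is orthogonal to a
primitive null vector `e` (`exists_isotropic_orthogonal`).

All primitive null vectors are equivalent (`exists_smul_eq_isotropic`: there is one cusp), so `e`
can be moved to `(1,0,0)` and `v` becomes `(a,b,0)` with `|b|² = j`. As `a`, `b` are coprime and `b`
is a unit or has a two-element residue ring, `a ≡ 1` mod `b` (`exists_sub_mul_eq_one`); a Heisenberg
translation then makes `a = 1`. The few remaining values of `b` are identified by explicit matrices,
so every `v` reaches `stdVec j`. Lines inherit transitivity since `polarLine` is equivariant. -/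

namespace PicardSeven

open ComplexConjugate

/-! ### The ring of integers as `ℤ[om]` -/

/-- The copy of `𝓞₇` inside `ℂ`. -/
noncomputable def intC : Subring ℂ := (algebraMap O7 ℂ).range

/-- The generator `(1 + i√7)/2` of `𝓞₇`. -/
noncomputable def om : ℂ := (1 + Complex.I * (Real.sqrt 7 : ℂ)) / 2

lemma sqrt_seven_sq : (Real.sqrt 7 : ℂ) ^ 2 = 7 := by
  rw [← Complex.ofReal_pow, Real.sq_sqrt (by norm_num)]; norm_num

lemma gen_sq : (Complex.I * (Real.sqrt 7 : ℂ)) ^ 2 = -7 := by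
  rw [mul_pow, sqrt_seven_sq, Complex.I_sq]; ring

lemma om_sq : om ^ 2 = om - 2 := by
  have h := gen_sq
  unfold om
  linear_combination h / 4

lemma conj_om : conj om = 1 - om := by
  unfold om
  simp only [map_div₀, map_add, map_mul, map_one, Complex.conj_I, Complex.conj_ofReal,
    Complex.conj_ofNat]
  ring

lemma om_mul_conj : om * conj om = 2 := by
  rw [conj_om]; linear_combination -om_sq

lemma om_re : om.re = 1 / 2 := by simp [om]

lemma om_im : om.im = Real.sqrt 7 / 2 := by simp [om]

lemma om_mem_K : om ∈ K := by
  have h : Complex.I * (Real.sqrt 7 : ℂ) ∈ K :=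
    IntermediateField.subset_adjoin _ _ (Set.mem_singleton _)
  exact K.div_mem (K.add_mem K.one_mem h) (ofNat_mem K 2)

lemma isIntegral_om : IsIntegral ℤ om := by
  refine ⟨Polynomial.X ^ 2 - Polynomial.X + 2, by monicity!, ?_⟩
  rw [← Polynomial.aeval_def]
  simp only [map_add, map_sub, map_pow, Polynomial.aeval_X, map_ofNat, om_sq]
  ring

lemma om_mem : om ∈ intC := by
  have h : IsIntegral ℤ (⟨om, om_mem_K⟩ : K) :=
    (isIntegral_algebraMap_iff (algebraMap K ℂ).injective).1 isIntegral_om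
  exact ⟨⟨_, h⟩, rfl⟩

lemma exists_rat_of_mem_K {z : ℂ} (hz : z ∈ K) :
    ∃ p q : ℚ, z = p + q * (Complex.I * (Real.sqrt 7 : ℂ)) := by
  induction hz using IntermediateField.adjoin_induction with
  | mem x hx => exact ⟨0, 1, by rw [Set.mem_singleton_iff.1 hx]; push_cast; ring⟩
  | algebraMap x => exact ⟨x, 0, by simp⟩
  | add x y _ _ hx hy =>
    obtain ⟨p, q, rfl⟩ := hx
    obtain ⟨r, s, rfl⟩ := hy
    exact ⟨p + r, q + s, by push_cast; ring⟩
  | mul x y _ _ hx hy =>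
    obtain ⟨p, q, rfl⟩ := hx
    obtain ⟨r, s, rfl⟩ := hy
    refine ⟨p * r - 7 * q * s, p * s + q * r, ?_⟩
    push_cast
    linear_combination (q * s : ℂ) * gen_sq
  | inv x _ hx =>
    obtain ⟨p, q, rfl⟩ := hx
    by_cases h : p ^ 2 + 7 * q ^ 2 = 0
    · have hp : p = 0 := by nlinarith [sq_nonneg p, sq_nonneg q]
      have hq : q = 0 := by nlinarith [sq_nonneg p, sq_nonneg q]
      exact ⟨0, 0, by simp [hp, hq]⟩
    · refine ⟨p / (p ^ 2 + 7 * q ^ 2), -q / (p ^ 2 + 7 * q ^ 2), ?_⟩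
      have h' : (p ^ 2 + 7 * q ^ 2 : ℂ) ≠ 0 := by exact_mod_cast h
      apply inv_eq_of_mul_eq_one_right
      push_cast
      linear_combination mul_inv_cancel₀ h' - (q : ℂ) ^ 2 * ((p : ℂ) ^ 2 + 7 * (q : ℂ) ^ 2)⁻¹ * gen_sq

lemma exists_int_of_isIntegral_rat {q : ℚ} {z : ℂ} (hz : IsIntegral ℤ z) (h : z = q) :
    ∃ n : ℤ, q = n := by
  have h1 : IsIntegral ℤ (algebraMap ℚ ℂ q) := by simpa [← h] using hz
  have h2 : IsIntegral ℤ q := (isIntegral_algebraMap_iff (algebraMap ℚ ℂ).injective).1 h1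
  obtain ⟨n, hn⟩ := IsIntegrallyClosed.isIntegral_iff.1 h2
  exact ⟨n, by simpa using hn.symm⟩

/-- Trace and norm of an integral `p + q·i√7` are integers, which forces `2p` and `2q` to be
integers of equal parity. -/
lemma mem_intC_iff {z : ℂ} : z ∈ intC ↔ ∃ m n : ℤ, z = m + n * om := by
  constructor
  · rintro ⟨x, rfl⟩
    have hint : IsIntegral ℤ (algebraMap O7 ℂ x) := (NumberField.RingOfIntegers.isIntegral x).algebraMap
    have hK : algebraMap O7 ℂ x ∈ K := (x : K).2
    generalize algebraMap O7 ℂ x = z at hint hK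
    obtain ⟨p, q, hz⟩ := exists_rat_of_mem_K hK
    have hc : conj z = p - q * (Complex.I * (Real.sqrt 7 : ℂ)) := by
      rw [hz]
      simp only [map_add, map_mul, Complex.conj_I, Complex.conj_ofReal, map_ratCast]
      ring
    have hcint : IsIntegral ℤ (conj z) := hint.map (starRingEnd ℂ).toIntAlgHom
    obtain ⟨m, hm⟩ := exists_int_of_isIntegral_rat (q := 2 * p) (hint.add hcint)
      (by rw [hc, hz]; push_cast; ring)
    obtain ⟨n, hn⟩ := exists_int_of_isIntegral_rat (q := p ^ 2 + 7 * q ^ 2) (hint.mul hcint)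
      (by rw [hc, hz]; push_cast; linear_combination (-q ^ 2 : ℂ) * gen_sq)
    have hk2 : (14 * q) ^ 2 = ((7 * (4 * n - m ^ 2) : ℤ) : ℚ) := by
      push_cast
      rw [← hm, ← hn]; ring
    -- The factor 14 makes the square an integer, so `14q` is integral; since 7 divides that square,
    -- `2q` is an integer too.
    obtain ⟨k, hk⟩ : ∃ k : ℤ, 14 * q = k := by
      have : IsIntegral ℤ ((14 * q) ^ 2) := by rw [hk2]; exact isIntegral_algebraMap
      obtain ⟨k, hk⟩ := IsIntegrallyClosed.isIntegral_iff.1 (this.of_pow (by norm_num))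
      exact ⟨k, by simpa using hk.symm⟩
    rw [hk] at hk2
    have hk3 : k ^ 2 = 7 * (4 * n - m ^ 2) := by exact_mod_cast hk2
    obtain ⟨l, rfl⟩ : (7 : ℤ) ∣ k :=
      Prime.dvd_of_dvd_pow (by norm_num : Prime (7 : ℤ)) ⟨_, hk3⟩
    have hl : 7 * l ^ 2 = 4 * n - m ^ 2 := by linarith
    have hpar : (2 : ℤ) ∣ m - l := by
      have h1 : Even ((m - l) ^ 2) := ⟨2 * n - 3 * l ^ 2 - m * l, by linear_combination hl⟩
      exact ((Int.even_pow' two_ne_zero).1 h1).two_dvd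
    obtain ⟨r, hr⟩ := hpar
    refine ⟨r, l, ?_⟩
    have h1 : (m : ℂ) - l = 2 * r := by exact_mod_cast hr
    have h2 : (2 : ℂ) * p = m := by exact_mod_cast hm
    have h3 : (14 : ℂ) * q = 7 * l := by exact_mod_cast hk
    rw [hz, om]
    linear_combination h2 / 2 + h3 / 14 * (Complex.I * (Real.sqrt 7 : ℂ)) + h1 / 2
  · rintro ⟨m, n, rfl⟩
    exact intC.add_mem (intCast_mem _ _) (intC.mul_mem (intCast_mem _ _) om_mem)

lemma conj_mem {z : ℂ} (hz : z ∈ intC) : conj z ∈ intC := by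
  obtain ⟨m, n, rfl⟩ := mem_intC_iff.1 hz
  simp only [map_add, map_mul, map_intCast, conj_om]
  exact intC.add_mem (intCast_mem _ _)
    (intC.mul_mem (intCast_mem _ _) (intC.sub_mem intC.one_mem om_mem))

lemma normSq_int (m n : ℤ) :
    Complex.normSq (m + n * om) = ((m ^ 2 + m * n + 2 * n ^ 2 : ℤ) : ℝ) := by
  have h : Real.sqrt 7 ^ 2 = 7 := Real.sq_sqrt (by norm_num)
  simp only [Complex.normSq_apply, Complex.add_re, Complex.add_im, Complex.mul_re, Complex.mul_im,
    Complex.intCast_re, Complex.intCast_im, om_re, om_im]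
  push_cast
  linear_combination (n ^ 2 / 4 : ℝ) * h

lemma exists_nat_normSq {z : ℂ} (hz : z ∈ intC) : ∃ n : ℕ, Complex.normSq z = n := by
  obtain ⟨m, n, rfl⟩ := mem_intC_iff.1 hz
  have h := normSq_int m n
  have h0 : (0 : ℤ) ≤ m ^ 2 + m * n + 2 * n ^ 2 := by
    exact_mod_cast h ▸ Complex.normSq_nonneg _
  lift (m ^ 2 + m * n + 2 * n ^ 2) to ℕ using h0 with N
  exact ⟨N, by simpa using h⟩

/-! ### Euclidean division and primitive vectors -/

lemma exists_near (z : ℂ) : ∃ q ∈ intC, Complex.normSq (z - q) < 1 := by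
  have h7 : Real.sqrt 7 ^ 2 = 7 := Real.sq_sqrt (by norm_num)
  have hpos : 0 < Real.sqrt 7 := Real.sqrt_pos.2 (by norm_num)
  set n := round (2 * z.im / Real.sqrt 7) with hn
  set m := round (z.re - n / 2) with hm
  refine ⟨m + n * om, mem_intC_iff.2 ⟨m, n, rfl⟩, ?_⟩
  have e1 := abs_le.1 (abs_sub_round (2 * z.im / Real.sqrt 7))
  have e2 := abs_le.1 (abs_sub_round (z.re - n / 2))
  rw [← hn] at e1
  rw [← hm] at e2
  set t := 2 * z.im / Real.sqrt 7 - n with ht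
  set s := z.re - n / 2 - m with hs
  have hre : (z - (m + n * om)).re = s := by simp [om_re, hs]; ring
  have him : (z - (m + n * om)).im = t * Real.sqrt 7 / 2 := by
    simp [om_im, ht]; field_simp
  rw [Complex.normSq_apply, hre, him]
  have : t * Real.sqrt 7 / 2 * (t * Real.sqrt 7 / 2) = 7 / 4 * t ^ 2 := by
    linear_combination t ^ 2 / 4 * h7
  rw [this]
  -- Both rounding errors are at most 1/2, so the norm is at most `1/4 + 7/16 = 11/16`.
  nlinarith

lemma exists_quotient (a : ℂ) {b : ℂ} (hb : b ≠ 0) :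
    ∃ q ∈ intC, Complex.normSq (a - q * b) < Complex.normSq b := by
  obtain ⟨q, hq, h⟩ := exists_near (a / b)
  refine ⟨q, hq, ?_⟩
  have : a - q * b = (a / b - q) * b := by field_simp
  rw [this, map_mul]
  exact mul_lt_of_lt_one_left (Complex.normSq_pos.2 hb) h

instance : IsPrincipalIdealRing intC where
  principal I := by
    by_cases hI : I = ⊥
    · rw [hI]; infer_instance
    obtain ⟨x, hxI, hx0⟩ := Submodule.exists_mem_ne_zero_of_ne_bot hI
    choose N hN using fun z : intC => exists_nat_normSq z.2
    obtain ⟨b, ⟨hbI, hb0⟩, hmin⟩ := exists_minimalFor_of_wellFoundedLT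
      (fun z : intC => z ∈ I ∧ z ≠ 0) N ⟨x, hxI, hx0⟩
    refine ⟨b, le_antisymm (fun a ha => ?_) ?_⟩
    · obtain ⟨q, hq, hlt⟩ := exists_quotient (a : ℂ) (b := b) (by simpa using hb0)
      have hmem : a - ⟨q, hq⟩ * b ∈ I := I.sub_mem ha (I.mul_mem_left _ hbI)
      have hlt' : N (a - ⟨q, hq⟩ * b) < N b := by
        have h1 := hN (a - ⟨q, hq⟩ * b)
        have h2 := hN b
        have : ((N (a - ⟨q, hq⟩ * b) : ℕ) : ℝ) < N b := by
          rw [← h1, ← h2]; simpa using hlt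
        exact_mod_cast this
      by_cases h0 : a - ⟨q, hq⟩ * b = 0
      · exact Ideal.mem_span_singleton'.2 ⟨⟨q, hq⟩, (sub_eq_zero.1 h0).symm⟩
      · exact absurd (hmin ⟨hmem, h0⟩ hlt'.le) (not_le.2 hlt')
    · exact (Ideal.span_singleton_le_iff_mem I).2 hbI

lemma exists_gcd {v : Fin 3 → ℂ} (hv : ∀ i, v i ∈ intC) :
    ∃ d ∈ intC, ∃ c : Fin 3 → ℂ, (∀ i, c i ∈ intC) ∧ c ⬝ᵥ v = d ∧
      ∃ w : Fin 3 → ℂ, (∀ i, w i ∈ intC) ∧ v = d • w := by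
  let u : Fin 3 → intC := fun i => ⟨v i, hv i⟩
  obtain ⟨d, hd⟩ := IsPrincipalIdealRing.principal (Ideal.span (Set.range u))
  have hdm : d ∈ Ideal.span (Set.range u) := by rw [hd]; exact Ideal.mem_span_singleton_self d
  obtain ⟨c, hc⟩ := Ideal.mem_span_range_iff_exists_fun.1 hdm
  have hw : ∀ i, ∃ w : intC, w * d = u i := fun i =>
    Ideal.mem_span_singleton'.1 (show u i ∈ Ideal.span {d} from
      hd.le (Ideal.subset_span ⟨i, rfl⟩))
  choose w hw using hw
  refine ⟨d, d.2, fun i => c i, fun i => (c i).2, ?_, fun i => w i, fun i => (w i).2, ?_⟩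
  · have := congrArg (Subtype.val) hc
    simpa [dotProduct, u] using this
  · funext i
    have := congrArg (Subtype.val) (hw i)
    simpa [u, mul_comm] using this.symm

/-- A vector with entries in `𝓞₇` which generate the unit ideal. -/
def Unimodular (v : Fin 3 → ℂ) : Prop :=
  (∀ i, v i ∈ intC) ∧ ∃ c : Fin 3 → ℂ, (∀ i, c i ∈ intC) ∧ c ⬝ᵥ v = 1

lemma exists_unimodular {v : Fin 3 → ℂ} (hv : ∀ i, v i ∈ intC) (h0 : v ≠ 0) :
    ∃ d : ℂ, d ≠ 0 ∧ ∃ w, Unimodular w ∧ v = d • w := by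
  obtain ⟨d, -, c, hc, hcd, w, hw, rfl⟩ := exists_gcd hv
  have hd : d ≠ 0 := by rintro rfl; simp at h0
  refine ⟨d, hd, w, ⟨hw, c, hc, ?_⟩, rfl⟩
  rw [dotProduct_smul, smul_eq_mul] at hcd
  exact mul_left_cancel₀ hd (by rw [hcd, mul_one])

lemma algebraMap_O7_injective : Function.Injective (algebraMap O7 ℂ) :=
  FaithfulSMul.algebraMap_injective O7 ℂ

lemma mem_primitiveVectors_iff {j : ℕ} {v : Fin 3 → ℂ} :
    v ∈ primitiveVectors j ↔ herm v v = j ∧ Unimodular v := by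
  refine and_congr_right fun _ => ⟨?_, ?_⟩
  · rintro ⟨u, hu, rfl⟩
    refine ⟨fun i => ⟨u i, rfl⟩, ?_⟩
    obtain ⟨d, ⟨d', rfl⟩, c, hc, hcd, w, hw, h⟩ :=
      exists_gcd (v := fun i => algebraMap O7 ℂ (u i)) fun i => ⟨u i, rfl⟩
    choose w' hw' using hw
    have hunit : IsUnit d' := hu d' fun i => ⟨w' i, algebraMap_O7_injective (by
      have := congrFun h i
      simpa [← hw'] using this)⟩
    obtain ⟨x, rfl⟩ := hunit
    refine ⟨algebraMap O7 ℂ (↑x⁻¹ : O7) • c, fun i => intC.mul_mem ⟨_, rfl⟩ (hc i), ?_⟩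
    rw [smul_dotProduct, hcd, smul_eq_mul, ← map_mul, Units.inv_mul, map_one]
  · rintro ⟨hv, c, hc, hcv⟩
    choose u hu using hv
    choose c' hc' using hc
    refine ⟨u, fun d hd => ?_, funext fun i => (hu i).symm⟩
    have h1 : c' ⬝ᵥ u = 1 := algebraMap_O7_injective (by
      simpa [dotProduct, hu, hc'] using hcv)
    exact isUnit_of_dvd_one (h1 ▸ Finset.dvd_sum fun i _ => (hd i).mul_left _)

/-! ### The Hermitian form and its integral unitary group -/

lemma herm_apply (v w : Fin 3 → ℂ) :
    herm v w = v 2 * conj (w 0) + v 1 * conj (w 1) + v 0 * conj (w 2) := by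
  simp [herm, J, dotProduct, Matrix.mulVec, Fin.sum_univ_three]
  ring

lemma conj_herm (v w : Fin 3 → ℂ) : conj (herm v w) = herm w v := by
  simp only [herm_apply, map_add, map_mul, Complex.conj_conj]
  ring

lemma UJO7_smul (g : UJO7) (v : Fin 3 → ℂ) :
    g • v = (g : GL (Fin 3) ℂ).1 *ᵥ v := rfl

lemma herm_mulVec {g : GL (Fin 3) ℂ} (hg : g ∈ UJ) (v w : Fin 3 → ℂ) :
    herm (g.1 *ᵥ v) (g.1 *ᵥ w) = herm v w := by
  have h : g.1ᴴ * J * g.1 = J := hg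
  unfold herm
  rw [Matrix.star_mulVec, Matrix.dotProduct_mulVec, Matrix.dotProduct_mulVec,
    Matrix.vecMul_vecMul, Matrix.vecMul_vecMul, ← Matrix.mul_assoc, h,
    ← Matrix.dotProduct_mulVec]

lemma herm_smul (g : UJO7) (v w : Fin 3 → ℂ) : herm (g • v) (g • w) = herm v w :=
  herm_mulVec g.2.1 v w

lemma entry_mem (g : UJO7) (i k : Fin 3) : (g : GL (Fin 3) ℂ).1 i k ∈ intC := by
  obtain ⟨x, hx⟩ := g.2.2
  exact ⟨x.1 i k, by rw [← hx]; rfl⟩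

lemma dotProduct_mem {v w : Fin 3 → ℂ} (hv : ∀ i, v i ∈ intC) (hw : ∀ i, w i ∈ intC) :
    v ⬝ᵥ w ∈ intC :=
  intC.sum_mem fun i _ => intC.mul_mem (hv i) (hw i)

lemma Unimodular.smul {v : Fin 3 → ℂ} (hv : Unimodular v) (g : UJO7) : Unimodular (g • v) := by
  obtain ⟨hv, c, hc, hcv⟩ := hv
  refine ⟨fun i => dotProduct_mem (fun k => entry_mem g i k) hv,
    c ᵥ* ((g⁻¹ : UJO7) : GL (Fin 3) ℂ).1,
    fun i => dotProduct_mem hc (fun k => entry_mem g⁻¹ k i), ?_⟩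
  rw [UJO7_smul, ← Matrix.dotProduct_mulVec, Matrix.mulVec_mulVec, ← Units.val_mul,
    ← Subgroup.coe_mul, inv_mul_cancel]
  simpa using hcv

lemma smul_mem_primitiveVectors {j : ℕ} {v : Fin 3 → ℂ} (g : UJO7)
    (hv : v ∈ primitiveVectors j) : g • v ∈ primitiveVectors j := by
  rw [mem_primitiveVectors_iff] at hv ⊢
  exact ⟨by rw [herm_smul, hv.1], hv.2.smul g⟩

lemma J_mul_J : J * J = 1 := by
  ext i k
  fin_cases i <;> fin_cases k <;> simp [J, Matrix.mul_apply, Fin.sum_univ_three]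

lemma J_mem (i k : Fin 3) : J i k ∈ intC := by
  fin_cases i <;> fin_cases k <;> simp [J, intC.zero_mem, intC.one_mem]

/-- The inverse `J * Aᴴ * J` is again integral, as conjugation preserves the ring. -/
lemma exists_mem_UJO7 {A : Matrix (Fin 3) (Fin 3) ℂ} (hA : ∀ i k, A i k ∈ intC)
    (h : Aᴴ * J * A = J) : ∃ g : UJO7, (g : GL (Fin 3) ℂ).1 = A := by
  have hBA : J * Aᴴ * J * A = 1 := by
    rw [Matrix.mul_assoc J, Matrix.mul_assoc J, h, J_mul_J]
  have hB : ∀ i k, (J * Aᴴ * J) i k ∈ intC := by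
    intro i k
    refine dotProduct_mem (fun l => dotProduct_mem (J_mem i) fun m => ?_) fun l => J_mem l k
    exact conj_mem (hA _ _)
  choose A' hA' using hA
  choose B' hB' using hB
  have hmap : ∀ X : Matrix (Fin 3) (Fin 3) O7, ∀ Y : Matrix (Fin 3) (Fin 3) O7,
      X.map (algebraMap O7 ℂ) * Y.map (algebraMap O7 ℂ) = 1 → X * Y = 1 := by
    intro X Y hXY
    apply Matrix.map_injective algebraMap_O7_injective
    change (X * Y).map (algebraMap O7 ℂ) = (1 : Matrix _ _ O7).map (algebraMap O7 ℂ)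
    rw [Matrix.map_mul, hXY, Matrix.map_one _ (map_zero _) (map_one _)]
  have eA : (Matrix.of A').map (algebraMap O7 ℂ) = A := by ext i k; exact hA' i k
  have eB : (Matrix.of B').map (algebraMap O7 ℂ) = J * Aᴴ * J := by ext i k; exact hB' i k
  let g' : GL (Fin 3) O7 := ⟨Matrix.of A', Matrix.of B',
    hmap _ _ (by rw [eA, eB]; exact mul_eq_one_comm.1 hBA),
    hmap _ _ (by rw [eA, eB]; exact hBA)⟩
  have hg : (Matrix.GeneralLinearGroup.map (n := Fin 3) (algebraMap O7 ℂ) g').1 = A := eA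
  refine ⟨⟨Matrix.GeneralLinearGroup.map (n := Fin 3) (algebraMap O7 ℂ) g', ?_, g', rfl⟩, hg⟩
  change _ᴴ * J * _ = J
  rw [hg, h]

/-- Three vectors with Gram matrix `J` are the columns of an element of `U(J, 𝓞₇)`. -/
lemma exists_smul_eq {e g f : Fin 3 → ℂ} (he : ∀ i, e i ∈ intC) (hg : ∀ i, g i ∈ intC)
    (hf : ∀ i, f i ∈ intC) (hee : herm e e = 0) (hff : herm f f = 0) (hgg : herm g g = 1)
    (hef : herm e f = 1) (heg : herm e g = 0) (hgf : herm g f = 0) :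
    ∃ A : UJO7, ∀ x y z : ℂ, A • ![x, y, z] = x • e + y • g + z • f := by
  have hfe : herm f e = 1 := by rw [← conj_herm, hef, map_one]
  have hge : herm g e = 0 := by rw [← conj_herm, heg, map_zero]
  have hfg : herm f g = 0 := by rw [← conj_herm, hgf, map_zero]
  have hcol : ∀ a b : Fin 3 → ℂ, herm a b =
      ∑ l, (∑ k, conj (b k) * J k l) * a l := by
    intro a b
    simp [herm_apply, Fin.sum_univ_three, J]
    ring
  obtain ⟨A, hA⟩ := exists_mem_UJO7 (A := (Matrix.of ![e, g, f])ᵀ)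
    (by intro i k; fin_cases k <;> simp [he, hg, hf])
    (by
      ext i k
      have : ((Matrix.of ![e, g, f])ᵀᴴ * J * (Matrix.of ![e, g, f])ᵀ) i k =
          herm (![e, g, f] k) (![e, g, f] i) := by
        rw [hcol]; rfl
      rw [this]
      fin_cases i <;> fin_cases k <;> simp [J, *])
  refine ⟨A, fun x y z => ?_⟩
  rw [UJO7_smul, hA]
  funext i
  simp [Matrix.mulVec, dotProduct, Fin.sum_univ_three]
  ring

/-! ### Null vectors -/

lemma exists_trace_eq {z : ℂ} (hz : z ∈ intC) (hr : conj z = z) :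
    ∃ t ∈ intC, t + conj t = z :=
  ⟨z * om, intC.mul_mem hz om_mem, by rw [map_mul, hr, conj_om]; ring⟩

lemma herm_mem {v w : Fin 3 → ℂ} (hv : ∀ i, v i ∈ intC) (hw : ∀ i, w i ∈ intC) :
    herm v w ∈ intC := by
  rw [herm_apply]
  exact intC.add_mem (intC.add_mem (intC.mul_mem (hv _) (conj_mem (hw _)))
    (intC.mul_mem (hv _) (conj_mem (hw _)))) (intC.mul_mem (hv _) (conj_mem (hw _)))

lemma herm_add_left (u v w : Fin 3 → ℂ) : herm (u + v) w = herm u w + herm v w := by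
  simp only [herm_apply, Pi.add_apply]; ring

lemma herm_add_right (u v w : Fin 3 → ℂ) : herm u (v + w) = herm u v + herm u w := by
  simp only [herm_apply, Pi.add_apply, map_add]; ring

lemma herm_smul_left (a : ℂ) (v w : Fin 3 → ℂ) : herm (a • v) w = a * herm v w := by
  simp only [herm_apply, Pi.smul_apply, smul_eq_mul]; ring

lemma herm_smul_right (a : ℂ) (v w : Fin 3 → ℂ) : herm v (a • w) = conj a * herm v w := by
  simp only [herm_apply, Pi.smul_apply, smul_eq_mul, map_mul]; ring

lemma exists_dual_isotropic {e : Fin 3 → ℂ} (he : Unimodular e) (hee : herm e e = 0) :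
    ∃ f : Fin 3 → ℂ, (∀ i, f i ∈ intC) ∧ herm f f = 0 ∧ herm e f = 1 := by
  obtain ⟨he, c, hc, hce⟩ := he
  let f : Fin 3 → ℂ := ![conj (c 2), conj (c 1), conj (c 0)]
  have hf : ∀ i, f i ∈ intC := by
    intro i; fin_cases i <;> simp [f, conj_mem, hc]
  have hef : herm e f = 1 := by
    rw [← hce, herm_apply]
    simp [f, dotProduct, Fin.sum_univ_three]
    ring
  have hfe : herm f e = 1 := by rw [← conj_herm, hef, map_one]
  obtain ⟨t, ht, htr⟩ := exists_trace_eq (intC.neg_mem (herm_mem hf hf))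
    (by rw [map_neg, conj_herm])
  -- Adding `t • e` keeps the pairing with `e` and changes the norm of `f` by the trace of `t`.
  refine ⟨f + t • e, fun i => intC.add_mem (hf i) (intC.mul_mem ht (he i)), ?_, ?_⟩
  · simp only [herm_add_left, herm_add_right, herm_smul_left, herm_smul_right, hee, hef, hfe]
    linear_combination htr
  · simp only [herm_add_right, herm_smul_right, hee, hef]
    ring

lemma exists_smul_eq_isotropic {e : Fin 3 → ℂ} (he : Unimodular e) (hee : herm e e = 0) :
    ∃ A : UJO7, A • ![1, 0, 0] = e := by
  obtain ⟨f, hf, hff, hef⟩ := exists_dual_isotropic he hee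
  have hfe : herm f e = 1 := by rw [← conj_herm, hef, map_one]
  have he' := fun i => conj_mem (he.1 i)
  have hf' := fun i => conj_mem (hf i)
  have key : ∀ a b c d : Fin 3, conj (e a) * conj (f b) - conj (e c) * conj (f d) ∈ intC :=
    fun a b c d => intC.sub_mem (intC.mul_mem (he' a) (hf' b)) (intC.mul_mem (he' c) (hf' d))
  -- `g` is `J` applied to the conjugate of the cross product of `e` and `f`: orthogonal to both,
  -- with norm `|⟨e,f⟩|² - ⟨e,e⟩⟨f,f⟩ = 1`.
  obtain ⟨A, hA⟩ := exists_smul_eq (e := e) (f := f)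
    (g := ![conj (e 0) * conj (f 1) - conj (e 1) * conj (f 0),
      conj (e 2) * conj (f 0) - conj (e 0) * conj (f 2),
      conj (e 1) * conj (f 2) - conj (e 2) * conj (f 1)]) he.1
    (by intro i; fin_cases i <;> simp only [] <;> exact key _ _ _ _) hf hee hff
    (by
      rw [herm_apply] at hee hff hef hfe
      rw [herm_apply]
      simp
      linear_combination (f 2 * conj (e 0) + f 1 * conj (e 1) + f 0 * conj (e 2)) * hef + hfe -
        (f 2 * conj (f 0) + f 1 * conj (f 1) + f 0 * conj (f 2)) * hee)
    hef
    (by rw [herm_apply]; simp; ring)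
    (by rw [herm_apply]; simp; ring)
  exact ⟨A, by simp [hA]⟩

lemma exists_isotropic_orthogonal {v : Fin 3 → ℂ} (hv : ∀ i, v i ∈ intC) {j : ℂ}
    (hvv : herm v v = j) {s : ℂ} (hs : s ∈ intC) (hsj : s * conj s = j) :
    ∃ e : Fin 3 → ℂ, Unimodular e ∧ herm e e = 0 ∧ herm v e = 0 := by
  have hj : j ∈ intC := hsj ▸ intC.mul_mem hs (conj_mem hs)
  have hjr : conj j = j := by rw [← hvv, conj_herm]
  by_cases h2 : v 2 = 0
  · refine ⟨![1, 0, 0], ⟨?_, ![1, 0, 0], ?_, by simp⟩, by simp [herm_apply], ?_⟩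
    · intro i; fin_cases i <;> simp [intC.one_mem, intC.zero_mem]
    · intro i; fin_cases i <;> simp [intC.one_mem, intC.zero_mem]
    · simp [herm_apply, h2]
  -- With `x = (1,0,0)` and `u = (-conj v₁, conj v₂, 0)`, this is `(j x - ⟨x,v⟩ v) + s u`. The two
  -- summands are orthogonal to `v` and to each other, of norms `-j|v₂|²` and `|s|²|v₂|²`, which
  -- cancel.
  let w : Fin 3 → ℂ := ![j - conj (v 2) * v 0 - s * conj (v 1),
    - conj (v 2) * v 1 + s * conj (v 2), - conj (v 2) * v 2]
  have hw : ∀ i, w i ∈ intC := by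
    have hc := fun i => conj_mem (hv i)
    intro i
    fin_cases i
    · exact intC.sub_mem (intC.sub_mem hj (intC.mul_mem (hc 2) (hv 0))) (intC.mul_mem hs (hc 1))
    · exact intC.add_mem (intC.mul_mem (intC.neg_mem (hc 2)) (hv 1)) (intC.mul_mem hs (hc 2))
    · exact intC.mul_mem (intC.neg_mem (hc 2)) (hv 2)
  have hw0 : w ≠ 0 := fun h => by
    have := congrFun h 2
    simp [w, h2] at this
  have hww : herm w w = 0 := by
    rw [herm_apply] at hvv ⊢
    simp [w, hjr]
    linear_combination (v 2 * conj (v 2)) * hvv + (v 2 * conj (v 2)) * hsj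
  have hvw : herm v w = 0 := by
    rw [herm_apply] at hvv ⊢
    simp [w, hjr]
    linear_combination - v 2 * hvv
  obtain ⟨d, hd, e, he, hwe⟩ := exists_unimodular hw hw0
  rw [hwe] at hww hvw
  rw [herm_smul_left, herm_smul_right] at hww
  rw [herm_smul_right] at hvw
  have hd' : conj d ≠ 0 := by simpa using hd
  exact ⟨e, he, by simpa [hd] using hww, by simpa [hd] using hvw⟩

/-! ### Elements of norm 1 and 2, and residues modulo them -/

lemma eq_of_normSq_eq_one {b : ℂ} (hb : b ∈ intC) (h : b * conj b = 1) : b = 1 ∨ b = -1 := by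
  obtain ⟨m, n, rfl⟩ := mem_intC_iff.1 hb
  rw [Complex.mul_conj, normSq_int] at h
  have h' : m ^ 2 + m * n + 2 * n ^ 2 = 1 := by exact_mod_cast h
  have hn : n = 0 := by
    have : n ^ 2 < 1 := by nlinarith [sq_nonneg (2 * m + n)]
    nlinarith
  subst hn
  have : m = 1 ∨ m = -1 := sq_eq_sq_iff_eq_or_eq_neg.1 (by linarith)
  rcases this with rfl | rfl <;> simp

lemma eq_of_normSq_eq_two {b : ℂ} (hb : b ∈ intC) (h : b * conj b = 2) :
    (b = om ∨ b = -om) ∨ b = conj om ∨ b = -conj om := by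
  obtain ⟨m, n, rfl⟩ := mem_intC_iff.1 hb
  rw [Complex.mul_conj, normSq_int] at h
  have h' : m ^ 2 + m * n + 2 * n ^ 2 = 2 := by exact_mod_cast h
  have hn1 : n ≤ 1 := by nlinarith [sq_nonneg (2 * m + n)]
  have hn2 : -1 ≤ n := by nlinarith [sq_nonneg (2 * m + n)]
  -- Eight times the norm is `(m + 4n)² + 7m²`.
  have hm1 : m ≤ 1 := by nlinarith [sq_nonneg (m + 4 * n)]
  have hm2 : -1 ≤ m := by nlinarith [sq_nonneg (m + 4 * n)]
  have hmn : (m = 0 ∧ n = 1) ∨ (m = 0 ∧ n = -1) ∨ (m = 1 ∧ n = -1) ∨ (m = -1 ∧ n = 1) := by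
    interval_cases m <;> interval_cases n <;> omega
  rw [conj_om]
  rcases hmn with ⟨rfl, rfl⟩ | ⟨rfl, rfl⟩ | ⟨rfl, rfl⟩ | ⟨rfl, rfl⟩ <;> push_cast
  · exact Or.inl (Or.inl (by ring))
  · exact Or.inl (Or.inr (by ring))
  · exact Or.inr (Or.inl (by ring))
  · exact Or.inr (Or.inr (by ring))

/-- Each `b` of norm 2 generates the ring together with 1, and divides 2; hence the parity of the
integer part decides the residue. -/
lemma dvd_or_dvd_sub_one {a b : ℂ} (ha : a ∈ intC) (hb : b ∈ intC) (h : b * conj b = 2) :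
    ∃ k ∈ intC, a = k * b ∨ a - 1 = k * b := by
  obtain ⟨m, n, rfl⟩ := mem_intC_iff.1 ha
  have key : ∀ x y : ℤ, ∃ k ∈ intC, (x : ℂ) + y * b = k * b ∨ (x : ℂ) + y * b - 1 = k * b := by
    intro x y
    obtain ⟨r, rfl | rfl⟩ := Int.even_or_odd' x
    · refine ⟨r * conj b + y, intC.add_mem (intC.mul_mem (intCast_mem _ _) (conj_mem hb))
        (intCast_mem _ _), Or.inl ?_⟩
      push_cast; linear_combination (-r : ℂ) * h
    · refine ⟨r * conj b + y, intC.add_mem (intC.mul_mem (intCast_mem _ _) (conj_mem hb))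
        (intCast_mem _ _), Or.inr ?_⟩
      push_cast; linear_combination (-r : ℂ) * h
  rcases eq_of_normSq_eq_two hb h with (rfl | rfl) | rfl | rfl
  · exact key m n
  · simpa using key m (-n)
  · have e : (m : ℂ) + n * om = (m + n : ℤ) + (-n : ℤ) * conj om := by
      rw [conj_om]; push_cast; ring
    rw [e]
    exact key (m + n) (-n)
  · have e : (m : ℂ) + n * om = (m + n : ℤ) + n * -conj om := by
      rw [conj_om]; push_cast; ring
    rw [e]
    exact key (m + n) n

lemma exists_sub_mul_eq_one {a b c d : ℂ} (ha : a ∈ intC) (hb : b ∈ intC) (hc : c ∈ intC)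
    (hd : d ∈ intC) (h : c * a + d * b = 1) (hbb : b * conj b = 1 ∨ b * conj b = 2) :
    ∃ s ∈ intC, a - s * b = 1 := by
  rcases hbb with hbb | hbb
  · refine ⟨(a - 1) * conj b, intC.mul_mem (intC.sub_mem ha intC.one_mem) (conj_mem hb), ?_⟩
    linear_combination (1 - a) * hbb
  obtain ⟨k, hk, hak | hak⟩ := dvd_or_dvd_sub_one ha hb hbb
  · exfalso
    have h1 : (c * k + d) * b = 1 := by rw [← h, hak]; ring
    obtain ⟨N, hN⟩ := exists_nat_normSq (intC.add_mem (intC.mul_mem hc hk) hd)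
    have h2 := congrArg Complex.normSq h1
    have h3 : Complex.normSq b = 2 := by
      rw [Complex.mul_conj] at hbb; exact_mod_cast hbb
    rw [map_mul, hN, h3, map_one] at h2
    have : N * 2 = 1 := by exact_mod_cast h2
    omega
  · exact ⟨k, hk, by linear_combination hak⟩

/-! ### Explicit group elements and reduction to `stdVec` -/

lemma exists_heisenberg {s : ℂ} (hs : s ∈ intC) :
    ∃ A : UJO7, ∀ a b : ℂ, A • ![a, b, 0] = ![a - s * b, b, 0] := by
  obtain ⟨t, ht, htr⟩ := exists_trace_eq (intC.neg_mem (intC.mul_mem hs (conj_mem hs)))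
    (by rw [map_neg, map_mul, Complex.conj_conj, mul_comm])
  obtain ⟨A, hA⟩ := exists_smul_eq (e := ![1, 0, 0]) (g := ![-s, 1, 0]) (f := ![t, conj s, 1])
    (by intro i; fin_cases i <;> simp [intC.one_mem, intC.zero_mem])
    (by intro i; fin_cases i <;> simp [intC.one_mem, intC.zero_mem, hs])
    (by intro i; fin_cases i <;> simp [intC.one_mem, conj_mem, hs, ht])
    (by simp [herm_apply]) (by simp [herm_apply]; linear_combination htr) (by simp [herm_apply])
    (by simp [herm_apply]) (by simp [herm_apply]) (by simp [herm_apply])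
  refine ⟨A, fun a b => ?_⟩
  rw [hA]
  funext i
  fin_cases i <;> simp
  ring

lemma exists_neg_snd : ∃ A : UJO7, ∀ a b : ℂ, A • ![a, b, 0] = ![a, -b, 0] := by
  obtain ⟨A, hA⟩ := exists_smul_eq (e := ![1, 0, 0]) (g := ![0, -1, 0]) (f := ![0, 0, 1])
    (by intro i; fin_cases i <;> simp [intC.one_mem, intC.zero_mem])
    (by intro i; fin_cases i <;> simp [intC.one_mem, intC.zero_mem])
    (by intro i; fin_cases i <;> simp [intC.one_mem, intC.zero_mem])
    (by simp [herm_apply]) (by simp [herm_apply]) (by simp [herm_apply])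
    (by simp [herm_apply]) (by simp [herm_apply]) (by simp [herm_apply])
  refine ⟨A, fun a b => ?_⟩
  rw [hA]
  funext i
  fin_cases i <;> simp

/-- `om` and `conj om` are not associates, so sign changes cannot exchange them. This matrix moves
`(1,0,0)`, so it is not in the stabilizer of that cusp. -/
lemma exists_smul_conj_om : ∃ A : UJO7, A • ![1, conj om, 0] = ![1, om, 0] := by
  obtain ⟨A, hA⟩ := exists_smul_eq (e := ![1, 1, -conj om]) (g := ![0, -1, 1]) (f := ![0, 0, 1])
    (by intro i; fin_cases i <;> simp [intC.one_mem, conj_mem om_mem])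
    (by intro i; fin_cases i <;> simp [intC.one_mem, intC.zero_mem])
    (by intro i; fin_cases i <;> simp [intC.one_mem, intC.zero_mem])
    (by simp [herm_apply]; linear_combination -conj_om) (by simp [herm_apply])
    (by simp [herm_apply])
    (by simp [herm_apply]) (by simp [herm_apply]) (by simp [herm_apply])
  refine ⟨A, ?_⟩
  rw [hA]
  funext i
  fin_cases i <;> simp [conj_om]

/-- A representative `(1, b, 0)` of the vectors of square norm `j`, where `|b|² = j`. -/
noncomputable def stdVec (j : ℕ) : Fin 3 → ℂ := ![1, if j = 1 then 1 else om, 0]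

lemma stdVec_mem {j : ℕ} (hj : j = 1 ∨ j = 2) : stdVec j ∈ primitiveVectors j := by
  rw [mem_primitiveVectors_iff]
  rcases hj with rfl | rfl
  · refine ⟨by simp [stdVec, herm_apply], ?_, ![1, 0, 0], ?_, by simp [stdVec]⟩ <;> intro i <;>
      fin_cases i <;> simp [stdVec, intC.one_mem, intC.zero_mem]
  · refine ⟨by simp [stdVec, herm_apply, om_mul_conj], ?_, ![1, 0, 0], ?_, by simp [stdVec]⟩ <;>
      intro i <;> fin_cases i <;> simp [stdVec, intC.one_mem, intC.zero_mem, om_mem]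

lemma exists_smul_eq_stdVec_of_fst_eq_one {j : ℕ} (hj : j = 1 ∨ j = 2) {b : ℂ} (hb : b ∈ intC)
    (h : b * conj b = j) : ∃ A : UJO7, A • ![1, b, 0] = stdVec j := by
  obtain ⟨N, hN⟩ := exists_neg_snd
  obtain ⟨S, hS⟩ := exists_smul_conj_om
  rcases hj with rfl | rfl
  · rcases eq_of_normSq_eq_one hb (by simpa using h) with rfl | rfl
    · exact ⟨1, by simp [stdVec]⟩
    · exact ⟨N, by simp [stdVec, hN]⟩
  · rcases eq_of_normSq_eq_two hb (by simpa using h) with (rfl | rfl) | rfl | rfl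
    · exact ⟨1, by simp [stdVec]⟩
    · exact ⟨N, by simp [stdVec, hN]⟩
    · exact ⟨S, by simp [stdVec, hS]⟩
    · exact ⟨S * N, by rw [mul_smul, hN, neg_neg, hS]; simp [stdVec]⟩

lemma exists_smul_eq_stdVec {j : ℕ} (hj : j = 1 ∨ j = 2) {v : Fin 3 → ℂ}
    (hv : v ∈ primitiveVectors j) : ∃ A : UJO7, A • v = stdVec j := by
  obtain ⟨s, hs, hsj⟩ : ∃ s ∈ intC, s * conj s = (j : ℂ) := by
    rcases hj with rfl | rfl
    · exact ⟨1, intC.one_mem, by simp⟩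
    · exact ⟨om, om_mem, by simp [om_mul_conj]⟩
  have hv' := mem_primitiveVectors_iff.1 hv
  obtain ⟨e, he, hee, hve⟩ := exists_isotropic_orthogonal hv'.2.1 hv'.1 hs hsj
  obtain ⟨A, hA⟩ := exists_smul_eq_isotropic he hee
  have hu := mem_primitiveVectors_iff.1 (smul_mem_primitiveVectors A⁻¹ hv)
  have h2 : (A⁻¹ • v) 2 = 0 := by
    have : herm (A⁻¹ • v) ![1, 0, 0] = 0 := by
      rw [← herm_smul A, smul_inv_smul, hA, hve]
    simpa [herm_apply] using this
  generalize hu' : A⁻¹ • v = u at hu h2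
  obtain ⟨huu, hmem, c, hc, hcu⟩ := hu
  have hbb : u 1 * conj (u 1) = j := by
    rw [← huu, herm_apply]; simp [h2]
  have hub : u = ![u 0, u 1, 0] := by
    funext i; fin_cases i <;> simp [h2]
  obtain ⟨t, ht, htu⟩ := exists_sub_mul_eq_one (hmem 0) (hmem 1) (hc 0) (hc 1)
    (by simpa [dotProduct, Fin.sum_univ_three, h2] using hcu)
    (by rw [hbb]; rcases hj with rfl | rfl <;> simp)
  obtain ⟨B, hB⟩ := exists_heisenberg ht
  obtain ⟨C, hC⟩ := exists_smul_eq_stdVec_of_fst_eq_one hj (hmem 1) hbb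
  refine ⟨C * B * A⁻¹, ?_⟩
  rw [mul_smul, mul_smul, hu', hub, hB, htu, hC]

theorem orbit_eq_primitiveVectors {j : ℕ} (hj : j = 1 ∨ j = 2) {v : Fin 3 → ℂ}
    (hv : v ∈ primitiveVectors j) : MulAction.orbit UJO7 v = primitiveVectors j := by
  apply Set.Subset.antisymm
  · rintro _ ⟨g, rfl⟩
    exact smul_mem_primitiveVectors g hv
  · intro w hw
    obtain ⟨A, hA⟩ := exists_smul_eq_stdVec hj hv
    obtain ⟨B, hB⟩ := exists_smul_eq_stdVec hj hw
    exact ⟨B⁻¹ * A, by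
      change (B⁻¹ * A) • v = w
      rw [mul_smul, hA, ← hB, inv_smul_smul]⟩

/-! ### Transfer to polar lines -/

lemma herm_self_smul_re (a : ℂ) (v : Fin 3 → ℂ) :
    (herm (a • v) (a • v)).re = Complex.normSq a * (herm v v).re := by
  rw [herm_smul_left, herm_smul_right, ← mul_assoc, Complex.mul_conj, Complex.re_ofReal_mul]

/-- Rescaling `x` multiplies its norm by a positive real, so the chosen representative is
irrelevant. -/
lemma mk_mem_polarLine {x : Fin 3 → ℂ} (hx : x ≠ 0) (v : Fin 3 → ℂ) :
    Projectivization.mk ℂ x hx ∈ polarLine v ↔ (herm x x).re < 0 ∧ herm x v = 0 := by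
  obtain ⟨a, ha⟩ := Projectivization.exists_smul_eq_mk_rep ℂ x hx
  have ha' : (a : ℂ) • x = (Projectivization.mk ℂ x hx).rep := ha
  have hpos : 0 < Complex.normSq (a : ℂ) := Complex.normSq_pos.2 a.ne_zero
  simp only [polarLine, hyperbolicPlane, Set.mem_ofPred_eq, ← ha']
  rw [herm_self_smul_re, herm_smul_left, mul_eq_zero, or_iff_right a.ne_zero,
    ← smul_eq_mul, smul_neg_iff_of_pos_left hpos]

lemma mk_smul_polarLine (g : UJO7) (v : Fin 3 → ℂ) :
    Matrix.ProjGenLinGroup.mk (g : GL (Fin 3) ℂ) • polarLine v = polarLine (g • v) := by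
  have key : ∀ (h : UJO7) (p : ℙ ℂ (Fin 3 → ℂ)) (w : Fin 3 → ℂ), p ∈ polarLine w →
      Matrix.ProjGenLinGroup.mk (h : GL (Fin 3) ℂ) • p ∈ polarLine (h • w) := by
    intro h p w hp
    induction p using Projectivization.ind with | _ x hx =>
    rw [Projectivization.PGL.mk_smul_mk]
    rw [mk_mem_polarLine] at hp ⊢
    change (herm (h • x) (h • x)).re < 0 ∧ herm (h • x) (h • w) = 0
    rwa [herm_smul, herm_smul]
  ext p
  rw [Set.mem_smul_set_iff_inv_smul_mem]
  constructor
  · intro hp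
    simpa using key g _ _ hp
  · intro hp
    have := key g⁻¹ _ _ hp
    rwa [inv_smul_smul, Subgroup.coe_inv, map_inv] at this

theorem orbit_eq_jLines {j : ℕ} (hj : j = 1 ∨ j = 2) {L : Set (ℙ ℂ (Fin 3 → ℂ))}
    (hL : L ∈ jLines j) : MulAction.orbit Γ L = jLines j := by
  obtain ⟨v, hv, rfl⟩ := hL
  rw [jLines, ← orbit_eq_primitiveVectors hj hv]
  ext M
  constructor
  · rintro ⟨⟨_, g, hg, rfl⟩, rfl⟩
    exact ⟨_, ⟨⟨g, hg⟩, rfl⟩, (mk_smul_polarLine ⟨g, hg⟩ v).symm⟩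
  · rintro ⟨_, ⟨g, rfl⟩, rfl⟩
    exact ⟨⟨_, g, g.2, rfl⟩, mk_smul_polarLine g v⟩

end PicardSeven

theorem mainTheorem6 (j : ℕ) (hj : j = 1 ∨ j = 2) :
    ((PicardSeven.primitiveVectors j).Nonempty ∧
      ∀ v ∈ PicardSeven.primitiveVectors j,
        MulAction.orbit PicardSeven.UJO7 v = PicardSeven.primitiveVectors j) ∧
    ((PicardSeven.jLines j).Nonempty ∧
      ∀ L ∈ PicardSeven.jLines j,
        MulAction.orbit PicardSeven.Γ L = PicardSeven.jLines j) :=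
  ⟨⟨⟨_, PicardSeven.stdVec_mem hj⟩, fun _ => PicardSeven.orbit_eq_primitiveVectors hj⟩,
    ⟨_, Set.mem_image_of_mem _ (PicardSeven.stdVec_mem hj)⟩,
    fun _ => PicardSeven.orbit_eq_jLines hj⟩
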